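/- **Setting.** Let $\nu>0$. For each $M$ let $\mathbf x^{(M)}\in\mathbb C^M$ be a vector with support $\mathcal I=\{i: x_i\neq 0\}$, sparsity $L=L^{(M)}=\|\mathbf x^{(M)}\|_0=|\mathcal I|$ and smallest non-zero magnitude $\mu(\mathbf x^{(M)})=\min_{i\in\mathcal I}|x_i|$. One observes $\mathbf y=\mathbf A\mathbf x^{(M)}+\mathbf n\in\mathbb C^N$, $N=N(M)$, where the $N\times M$ matrix $\mathbf A$ has i.i.d. $\mathcal N_{\mathbb C}(0,1)$ (circularly-symmetric complex Gaussian) entries and $\mathbf n\sim\mathcal N_{\mathbb C}(0,\nu^2 I_N)$ is independent of $\mathbf A$. For a set $\mathcal J\subset\{1,\dots,M\}$ with $|\mathcal J|=L$, let $\mathbf A_{\mathcal J}$ be the submatrix of the columns of $\mathbf A$ with index in $\mathcal J$, and let $\Pi^\perp_{\mathbf A_{\mathcal J}}$ be the orthogonal projection onto the orthogonal complement of its column space. For $\delta>0$, $\mathbf y$ and $\mathcal J$ are *$\delta$-jointly typical* if $\operatorname{rank}(\mathbf A_{\mathcal J})=L$ and $$\Big|\tfrac1N\big\|\Pi^\perp_{\mathbf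 A_{\mathcal J}}\mathbf y\big\|^2-\tfrac{N-L}{N}\nu^2\Big|<\delta .$$ The *joint-typicality decoder* with tolerance $\delta$ outputs the set $\mathcal J$ with $|\mathcal J|=L$ that is $\delta$-jointly typical with $\mathbf y$ if there is exactly one such set, and fails (outputs $\emptyset$) otherwise. The error probability of a decoder $\mathcal D$ for exact support recovery (Error Metric 1, the $0$-$1$ loss), averaged over the Gaussian ensemble, is $$p_{\rm err}(\mathcal D\mid\mathbf x^{(M)})=\mathbb E_{\mathbf A}\big[\mathbb P_{\mathbf n}(\mathcal D(\mathbf y)\neq\mathcal I)\big].$$ **Theorem (sublinear achievability, Error Metric 1).** There are a tolerance rule $\delta=\delta(\mu,\nu,N,L)$, which is positive whenever $\mu,\nu>0$, and, for every $\nu>0$ and every sequence $(\mu_M)_M$, a constant $C'_1>0$ depending only on $(\mu_M)_M$ and $\nu$, such that the following holds. Let $\{\mathbf x^{(M)}\in\mathbb C^M\}_M$ be a sequence of vectors with $\mu(\mathbf x^{(M)})=\mu_M$ for all $M$, with $L=\|\mathbf x^{(M)}\|_0=o(M)$, and with $L\,\mu^4(\mathbf x^{(M)})\to\infty$ as $M\to\infty$.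 If $$N(M)>C'_1\,L\log(M-L)\qquad\text{for all sufficiently large }M,$$ then the joint-typicality decoder with tolerance $\delta(\mu(\mathbf x^{(M)}),\nu,N,L)$ achieves asymptotically reliable exact support recovery: $$p_{\rm err}(\mathcal D\mid\mathbf x^{(M)})\to0\qquad\text{as }M\to\infty .$$ -/

import Mathlib

open MeasureTheory ProbabilityTheory Filter
open scoped Matrix Asymptotics

namespace SparseRecovery

noncomputable section

/-- The circularly-symmetric complex Gaussian law `N_C(0, σ²)` on `ℂ`: real and imaginary parts are
independent centered real Gaussians, each of variance `σ² / 2`. -/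
def complexGaussian (σ : ℝ) : Measure ℂ :=
  ((gaussianReal 0 (Real.toNNReal (σ ^ 2 / 2))).prod
    (gaussianReal 0 (Real.toNNReal (σ ^ 2 / 2)))).map Complex.measurableEquivRealProd.symm

instance (σ : ℝ) : IsProbabilityMeasure (complexGaussian σ) :=
  Measure.isProbabilityMeasure_map Complex.measurableEquivRealProd.symm.measurable.aemeasurable

/-- The law of the noise vector: `N` i.i.d. entries with law `N_C(0, ν²)`,
that is `N_C(0, ν² I_N)`. -/
def noiseLaw (ν : ℝ) (N : ℕ) : Measure (Fin N → ℂ) :=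
  Measure.pi fun _ => complexGaussian ν

/-- The Gaussian ensemble of `N × M` measurement matrices, given as families of entries:
i.i.d. entries with law `N_C(0, 1)`. -/
def matrixLaw (N M : ℕ) : Measure (Fin N → Fin M → ℂ) :=
  Measure.pi fun _ => Measure.pi fun _ => complexGaussian 1

/-- The support of `x`. Its cardinality is the sparsity `‖x‖₀`. -/
def supp {M : ℕ} (x : Fin M → ℂ) : Finset (Fin M) :=
  {i | x i ≠ 0}

/-- The sparsity `‖x‖₀`, the number of non-zero coefficients. -/
def sparsity {M : ℕ} (x : Fin M → ℂ) : ℕ :=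
  (supp x).card

/-- `μ(x)`, the minimum of `|x i|` over the support of `x` (and `0` if the support is empty). -/
def minMagnitude {M : ℕ} (x : Fin M → ℂ) : ℝ :=
  ⨅ i : supp x, ‖x i‖

/-- `A_J`, the matrix whose columns are the columns of `A` with index in `J`. -/
def columns {N M : ℕ} (A : Matrix (Fin N) (Fin M) ℂ) (J : Finset (Fin M)) : Matrix (Fin N) J ℂ :=
  A.submatrix id Subtype.val

/-- The subspace of `ℂ^N` (with its Euclidean structure) spanned by the columns of `A_J`. -/
def columnSpace {N M : ℕ} (A : Matrix (Fin N) (Fin M) ℂ) (J : Finset (Fin M)) :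
    Submodule ℂ (EuclideanSpace ℂ (Fin N)) :=
  Submodule.span ℂ (Set.range fun j : J => WithLp.toLp 2 ((columns A J).col j))

/-- `‖Π^⊥ y‖²`, where `Π^⊥` is the orthogonal projection of `ℂ^N` onto the orthogonal complement
of the column space of `A_J`. -/
def residual {N M : ℕ} (A : Matrix (Fin N) (Fin M) ℂ) (J : Finset (Fin M)) (y : Fin N → ℂ) : ℝ :=
  ‖(columnSpace A J)ᗮ.starProjection (WithLp.toLp 2 y)‖ ^ 2

/-- The observation `y` and the set `J` of `L` indices are `δ`-jointly typical. -/
def JointlyTypical {N M : ℕ} (ν δ : ℝ) (L : ℕ) (A : Matrix (Fin N) (Fin M) ℂ) (y : Fin N → ℂ)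
    (J : Finset (Fin M)) : Prop :=
  J.card = L ∧ (columns A J).rank = L ∧
    |1 / (N : ℝ) * residual A J y - ((N : ℝ) - L) / N * ν ^ 2| < δ

/-- A decoder maps the measurement matrix and the observation to a set of indices. -/
abbrev Decoder (N M : ℕ) : Type :=
  Matrix (Fin N) (Fin M) ℂ → (Fin N → ℂ) → Finset (Fin M)

open Classical in
/-- The joint-typicality decoder: it outputs the set of `L` indices that is `δ`-jointly typical with
the observation if there is exactly one, and fails (with output `∅`) otherwise. -/
def jointTypicalityDecoder (N M : ℕ) (ν δ : ℝ) (L : ℕ) : Decoder N M := fun A y =>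
  if h : ∃! J : Finset (Fin M), JointlyTypical ν δ L A y J then h.choose else ∅

/-- `p_err(A | x) = P(D(y) ≠ supp x)` for `y = A x + n`, `n ∼ N_C(0, ν² I_N)` and a fixed matrix `A`:
the probability that the decoder does not recover the support of `x` exactly. -/
def errorProbGiven {N M : ℕ} (D : Decoder N M) (ν : ℝ) (x : Fin M → ℂ)
    (A : Matrix (Fin N) (Fin M) ℂ) : ENNReal :=
  noiseLaw ν N {n | D A (A *ᵥ x + n) ≠ supp x}

/-- `p_err(D | x)`, the average of `p_err(A | x)` over the Gaussian ensemble of matrices. -/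
def errorProb {N M : ℕ} (D : Decoder N M) (ν : ℝ) (x : Fin M → ℂ) : ENNReal :=
  ∫⁻ A, errorProbGiven D ν x (Matrix.of A) ∂(matrixLaw N M)

/-- A sequence of decoders achieves asymptotic reliable (exact support) recovery for the sequence
`x` with `N M` measurements at stage `M`. -/
def AsymptoticReliable (N : ℕ → ℕ) (D : (M : ℕ) → Decoder (N M) M) (ν : ℝ)
    (x : (M : ℕ) → Fin M → ℂ) : Prop :=
  Tendsto (fun M => errorProb (D M) ν (x M)) atTop (nhds 0)

end

end SparseRecovery

/-! ### Gaussian vectors: projections, sums, and independence of columns. -/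

namespace SparseRecovery

/-! Fix `J` with `L` elements and put `d = N - L`. Projecting off the columns in `J` kills their
share of `A x`; the rest of `A x` plus the noise is a Gaussian vector independent of those columns,
with variance `effectiveVariance ν x J` per coordinate (`measurePreserving_columns_noise`,
`residual_mulVec_add`). So, given columns of full rank, the residual is the squared norm of a
Gaussian vector in `ℂ^d`, and Chernoff bounds apply.

For the true support this variance is `ν²`; for a set missing `k` support indices it is at least `ν²
+ kμ²`. The tolerance `μ²/4` separates the two cases. Once `d ≥ 128 L log (M - L)` and `Lμ⁴ ≥ ν⁴`, a
set missing `k` indices passes the test with probability at most `(M - L)^(-4k)`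
(`le_sq_energy_gap`), which survives the union bound over all wrong sets (`errorProb_le`,
`sum_pow_card_sdiff_le`). The true support is almost surely of full rank (`ae_finrank_colSpan_eq`)
and fails the test with probability tending to 0, since `Lμ⁴ → ∞` and `M - L → ∞`.
`errorProb_le_explicit` collects these estimates for fixed `M`. -/

instance (ν : ℝ) (N : ℕ) : IsProbabilityMeasure (noiseLaw ν N) := by
  unfold noiseLaw; infer_instance

instance (N M : ℕ) : IsProbabilityMeasure (matrixLaw N M) := by
  unfold matrixLaw; infer_instance

/-- Only `‖t‖` enters, which is circular symmetry. The identities of laws below reduce to this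
formula, valid also for `σ = 0`. -/
theorem charFun_complexGaussian (σ : ℝ) (t : ℂ) :
    charFun (complexGaussian σ) t = Complex.exp (-(σ ^ 2 * ‖t‖ ^ 2 / 4 : ℝ)) := by
  rw [complexGaussian, charFun_apply, integral_map_equiv]
  have h (p : ℝ × ℝ) :
      Complex.exp (inner ℝ (Complex.measurableEquivRealProd.symm p) t * Complex.I) =
        Complex.exp (t.re * p.1 * Complex.I) * Complex.exp (t.im * p.2 * Complex.I) := by
    rw [← Complex.exp_add, Complex.inner]
    congr 1
    simp
    ring
  simp_rw [h]
  rw [integral_prod_mul (fun x : ℝ => Complex.exp (t.re * x * Complex.I))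
    (fun x : ℝ => Complex.exp (t.im * x * Complex.I)), ← charFun_apply_real, ← charFun_apply_real,
    charFun_gaussianReal, charFun_gaussianReal, ← Complex.exp_add, ← Complex.normSq_eq_norm_sq,
    Complex.normSq_apply, Real.coe_toNNReal _ (by positivity)]
  congr 1
  push_cast
  ring

theorem charFun_noiseLaw (σ : ℝ) (N : ℕ) (t : EuclideanSpace ℂ (Fin N)) :
    charFun ((noiseLaw σ N).map (WithLp.toLp 2)) t =
      Complex.exp (-(σ ^ 2 * ‖t‖ ^ 2 / 4 : ℝ)) := by
  rw [noiseLaw, charFun_pi]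
  simp_rw [charFun_complexGaussian]
  rw [← Complex.exp_sum, EuclideanSpace.norm_sq_eq]
  congr 1
  push_cast
  rw [Finset.mul_sum, Finset.sum_div, Finset.sum_neg_distrib]

theorem real_inner_eq_re_complex_inner {n : ℕ} (u v : EuclideanSpace ℂ (Fin n)) :
    inner ℝ u v = (inner ℂ u v).re := by
  simp [PiLp.inner_apply, Complex.inner]

/-- The coordinates of a Gaussian vector along an orthonormal family are Gaussian. -/
theorem measurePreserving_inner_orthonormal (σ : ℝ) {N d : ℕ}
    {b : Fin d → EuclideanSpace ℂ (Fin N)} (hb : Orthonormal ℂ b) :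
    MeasurePreserving (fun w : Fin N → ℂ => fun i => inner ℂ (b i) (WithLp.toLp 2 w))
      (noiseLaw σ N) (noiseLaw σ d) := by
  have hm : Measurable (fun w : Fin N → ℂ => fun i => inner ℂ (b i) (WithLp.toLp 2 w)) := by
    fun_prop
  refine ⟨hm, ?_⟩
  refine (MeasurableEquiv.toLp 2 (Fin d → ℂ)).map_measurableEquiv_injective
      <| Measure.ext_of_charFun <| funext fun t ↦ ?_
  rw [MeasurableEquiv.coe_toLp, charFun_noiseLaw]
  have hnorm : ‖∑ i, t i • b i‖ ^ 2 = ‖t‖ ^ 2 := by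
    rw [EuclideanSpace.norm_sq_eq t, ← @inner_self_eq_norm_sq ℂ, hb.inner_sum]
    simp only [map_sum, ← Complex.normSq_eq_norm_sq]
    refine Finset.sum_congr rfl fun i _ => ?_
    simp [Complex.normSq_apply]
  -- The characteristic function of the coordinates at `t` is that of the original vector at `∑ i, t
  -- i • b i`, a vector of the same norm.
  rw [← hnorm, ← charFun_noiseLaw, charFun_apply, charFun_apply, ← MeasurableEquiv.coe_toLp,
    integral_map_equiv, integral_map hm.aemeasurable (by fun_prop), ← MeasurableEquiv.coe_toLp,
    integral_map_equiv]
  congr 1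
  ext w
  have : inner ℂ (WithLp.toLp 2 fun i => inner ℂ (b i) (WithLp.toLp 2 w)) t =
      inner ℂ (WithLp.toLp 2 w) (∑ i, t i • b i) := by
    rw [PiLp.inner_apply, inner_sum]
    simp only [inner_smul_right, RCLike.inner_apply, inner_conj_symm]
  rw [MeasurableEquiv.coe_toLp, MeasurableEquiv.coe_toLp, real_inner_eq_re_complex_inner, this,
    ← real_inner_eq_re_complex_inner]

theorem measurePreserving_add_noiseLaw {σ ν τ : ℝ} (h : τ ^ 2 = σ ^ 2 + ν ^ 2) (N : ℕ) :
    MeasurePreserving (fun p : (Fin N → ℂ) × (Fin N → ℂ) => p.1 + p.2)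
      ((noiseLaw σ N).prod (noiseLaw ν N)) (noiseLaw τ N) := by
  have hm : Measurable (fun p : (Fin N → ℂ) × (Fin N → ℂ) => p.1 + p.2) := by fun_prop
  refine ⟨hm, ?_⟩
  refine (MeasurableEquiv.toLp 2 (Fin N → ℂ)).map_measurableEquiv_injective
      <| Measure.ext_of_charFun <| funext fun t ↦ ?_
  have h0 : Complex.exp (-(τ ^ 2 * ‖t‖ ^ 2 / 4 : ℝ)) =
      Complex.exp (-(σ ^ 2 * ‖t‖ ^ 2 / 4 : ℝ)) * Complex.exp (-(ν ^ 2 * ‖t‖ ^ 2 / 4 : ℝ)) := by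
    rw [h, ← Complex.exp_add]
    congr 1
    push_cast
    ring
  rw [MeasurableEquiv.coe_toLp, charFun_noiseLaw, h0, ← charFun_noiseLaw, ← charFun_noiseLaw,
    charFun_apply, charFun_apply, charFun_apply, ← MeasurableEquiv.coe_toLp,
    integral_map_equiv, integral_map_equiv, integral_map_equiv,
    integral_map hm.aemeasurable (by fun_prop), ← integral_prod_mul]
  congr 1
  ext p
  rw [← Complex.exp_add, ← add_mul, ← Complex.ofReal_add, ← inner_add_left]
  rfl

theorem measurePreserving_sum_mul {ι : Type*} [Fintype ι] (z : ι → ℂ) {σ : ℝ}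
    (h : σ ^ 2 = ∑ i, ‖z i‖ ^ 2) :
    MeasurePreserving (fun a : ι → ℂ => ∑ i, a i * z i)
      (Measure.pi fun _ => complexGaussian 1) (complexGaussian σ) := by
  have hm : Measurable fun a : ι → ℂ => ∑ i, a i * z i := by fun_prop
  refine ⟨hm, ?_⟩
  refine Measure.ext_of_charFun <| funext fun t ↦ ?_
  have h0 : Complex.exp (-(σ ^ 2 * ‖t‖ ^ 2 / 4 : ℝ)) =
      ∏ i, Complex.exp (-(1 ^ 2 * ‖t * star (z i)‖ ^ 2 / 4 : ℝ)) := by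
    rw [← Complex.exp_sum, h]
    congr 1
    push_cast
    rw [Finset.sum_neg_distrib, Finset.sum_mul, Finset.sum_div]
    congr 1
    refine Finset.sum_congr rfl fun i _ => ?_
    rw [norm_mul, norm_star]
    push_cast
    ring
  rw [charFun_complexGaussian, h0, charFun_apply, integral_map hm.aemeasurable (by fun_prop)]
  simp_rw [← charFun_complexGaussian, charFun_apply]
  rw [← integral_fintype_prod_eq_prod]
  congr 1
  ext a
  rw [← Complex.exp_sum, ← Finset.sum_mul, sum_inner]
  congr 2
  push_cast
  refine Finset.sum_congr rfl fun i _ => ?_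
  congr 1
  simp [Complex.inner]
  ring

/-- The columns indexed by `K` and the combination of the remaining columns with coefficients `z`
are independent and Gaussian. -/
theorem measurePreserving_columns (N : ℕ) {M : ℕ} (K : Finset (Fin M)) (z : Fin M → ℂ) {σ : ℝ}
    (h : σ ^ 2 = ∑ i : {i // i ∉ K}, ‖z i‖ ^ 2) :
    MeasurePreserving (fun A : Fin N → Fin M → ℂ =>
        ((fun r (j : K) => A r j), fun r => ∑ i : {i // i ∉ K}, A r i * z i))
      (matrixLaw N M)
      ((Measure.pi fun _ => Measure.pi fun _ => complexGaussian 1).prod (noiseLaw σ N)) := by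
  have hsplit := measurePreserving_piEquivPiSubtypeProd (fun _ : Fin M => complexGaussian 1) (· ∈ K)
  rw [Subsingleton.elim (Subtype.fintype fun x => x ∈ K) (Finset.Subtype.fintype K)] at hsplit
  have hrow := ((MeasurePreserving.id (Measure.pi fun _ : K => complexGaussian 1)).prod
    (measurePreserving_sum_mul (fun i : {i // i ∉ K} => z i) h)).comp hsplit
  have hpi := measurePreserving_pi (ι := Fin N) _ _ (fun _ => hrow)
  exact (measurePreserving_arrowProdEquivProdArrow _ _ (Fin N) _ _).comp hpi

/-- The columns indexed by `K` and the noisy combination of the remaining columns with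
coefficients `z` are independent and Gaussian. -/
theorem measurePreserving_columns_noise (N : ℕ) {M : ℕ} (K : Finset (Fin M)) (z : Fin M → ℂ)
    {ν τ : ℝ} (h : τ ^ 2 = (∑ i : {i // i ∉ K}, ‖z i‖ ^ 2) + ν ^ 2) :
    MeasurePreserving (fun p : (Fin N → Fin M → ℂ) × (Fin N → ℂ) =>
        ((fun r (j : K) => p.1 r j), fun r => (∑ i : {i // i ∉ K}, p.1 r i * z i) + p.2 r))
      ((matrixLaw N M).prod (noiseLaw ν N))
      ((Measure.pi fun _ => Measure.pi fun _ => complexGaussian 1).prod (noiseLaw τ N)) := by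
  -- Here `σ = 0` is allowed and does occur: `z` vanishes off `K` when `K` is the support.
  obtain ⟨σ, hσ⟩ : ∃ σ : ℝ, σ ^ 2 = ∑ i : {i // i ∉ K}, ‖z i‖ ^ 2 := ⟨_, Real.sq_sqrt (Finset.sum_nonneg fun (i : {i // i ∉ K}) (_ : i ∈ Finset.univ) =>
    sq_nonneg ‖z i‖)⟩
  have h1 := (measurePreserving_columns N K z hσ).prod (MeasurePreserving.id (noiseLaw ν N))
  have h2 := (measurePreserving_prodAssoc _ (noiseLaw σ N) (noiseLaw ν N)).comp h1
  have h0 : τ ^ 2 = σ ^ 2 + ν ^ 2 := by rw [h, hσ]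
  have hadd := measurePreserving_add_noiseLaw h0 N
  have : SFinite ((noiseLaw σ N).prod (noiseLaw ν N)) := Measure.prod.instSFinite
  have h3 := (MeasurePreserving.id (Measure.pi fun _ : Fin N => Measure.pi fun _ : K =>
    complexGaussian 1)).prod hadd
  exact h3.comp h2

end SparseRecovery
-- Chernoff bounds for projected Gaussian vectors.
namespace SparseRecovery

theorem integral_exp_neg_mul_sq_gaussianReal {v : NNReal} (hv : v ≠ 0) (l : ℝ) :
    ∫ x, Real.exp (-l * x ^ 2) ∂(gaussianReal 0 v) = √((1 + 2 * l * v)⁻¹) := by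
  have hv' : (0 : ℝ) < v := by positivity
  rw [integral_gaussianReal_eq_integral_smul hv]
  have h (x : ℝ) : gaussianPDFReal 0 v x • Real.exp (-l * x ^ 2) =
      (√(2 * Real.pi * v))⁻¹ * Real.exp (-((1 + 2 * l * v) / (2 * v)) * x ^ 2) := by
    rw [gaussianPDFReal, smul_eq_mul, mul_assoc, ← Real.exp_add]
    congr 2
    field_simp
    ring
  simp_rw [h]
  rw [integral_const_mul, integral_gaussian, ← Real.sqrt_inv, ← Real.sqrt_mul (by positivity)]
  congr 1
  field_simp

theorem integral_exp_neg_mul_norm_sq_complexGaussian {σ : ℝ} (hσ : 0 < σ) {l : ℝ}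
    (hl : 0 < 1 + l * σ ^ 2) :
    ∫ z, Real.exp (-l * ‖z‖ ^ 2) ∂(complexGaussian σ) = (1 + l * σ ^ 2)⁻¹ := by
  have hv : Real.toNNReal (σ ^ 2 / 2) ≠ 0 := by
    rw [Ne, Real.toNNReal_eq_zero]
    have : 0 < σ ^ 2 / 2 := by positivity
    linarith
  have hc : ((Real.toNNReal (σ ^ 2 / 2) : NNReal) : ℝ) = σ ^ 2 / 2 :=
    Real.coe_toNNReal _ (by positivity)
  have hl' : 0 < 1 + 2 * l * (Real.toNNReal (σ ^ 2 / 2) : NNReal) := by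
    rw [hc]; linarith
  rw [complexGaussian, integral_map_equiv]
  have h (p : ℝ × ℝ) : Real.exp (-l * ‖Complex.measurableEquivRealProd.symm p‖ ^ 2) =
      Real.exp (-l * p.1 ^ 2) * Real.exp (-l * p.2 ^ 2) := by
    rw [← Real.exp_add, ← Complex.normSq_eq_norm_sq, Complex.normSq_apply]
    congr 1
    simp
    ring
  simp_rw [h]
  rw [integral_prod_mul (fun x : ℝ => Real.exp (-l * x ^ 2)) (fun x : ℝ => Real.exp (-l * x ^ 2)),
    integral_exp_neg_mul_sq_gaussianReal hv l, Real.mul_self_sqrt (by positivity), hc]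
  congr 2
  ring

/-- The sign of `l` is left free: positive `l` serves the lower tail, negative `l` the upper one. -/
theorem mgf_norm_sq_noiseLaw {σ : ℝ} (hσ : 0 < σ) {l : ℝ} (hl : 0 < 1 + l * σ ^ 2) (d : ℕ) :
    mgf (fun w => ∑ i, ‖w i‖ ^ 2) (noiseLaw σ d) (-l) = ((1 + l * σ ^ 2)⁻¹) ^ d := by
  simp_rw [mgf, Finset.mul_sum, Real.exp_sum, noiseLaw]
  rw [integral_fintype_prod_eq_pow (fun z : ℂ => Real.exp (-l * ‖z‖ ^ 2)),
    integral_exp_neg_mul_norm_sq_complexGaussian hσ hl, Fintype.card_fin]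

/-- The squared norm of the projection of a Gaussian vector on a subspace of dimension `d` is
distributed as the squared norm of a Gaussian vector of `ℂ^d`. -/
theorem exists_measurePreserving_starProjection (σ : ℝ) {N : ℕ}
    (W : Submodule ℂ (EuclideanSpace ℂ (Fin N))) :
    ∃ f : (Fin N → ℂ) → Fin (Module.finrank ℂ W) → ℂ,
      MeasurePreserving f (noiseLaw σ N) (noiseLaw σ (Module.finrank ℂ W)) ∧
      ∀ w, ‖W.starProjection (WithLp.toLp 2 w)‖ ^ 2 = ∑ i, ‖f w i‖ ^ 2 := by
  set b := stdOrthonormalBasis ℂ W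
  refine ⟨_, measurePreserving_inner_orthonormal σ
    (b.orthonormal.comp_linearIsometry W.subtypeₗᵢ), fun w => ?_⟩
  rw [Submodule.starProjection_apply, ← Submodule.coe_norm, ← b.sum_sq_norm_inner_right]
  refine Finset.sum_congr rfl fun i _ => ?_
  simp

theorem mgf_norm_sq_starProjection {σ : ℝ} (hσ : 0 < σ) {l : ℝ} (hl : 0 < 1 + l * σ ^ 2) {N : ℕ}
    (W : Submodule ℂ (EuclideanSpace ℂ (Fin N))) :
    mgf (fun w => ‖W.starProjection (WithLp.toLp 2 w)‖ ^ 2) (noiseLaw σ N) (-l) =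
      ((1 + l * σ ^ 2)⁻¹) ^ Module.finrank ℂ W := by
  obtain ⟨f, hf, h⟩ := exists_measurePreserving_starProjection σ W
  simp_rw [h]
  rw [← mgf_norm_sq_noiseLaw hσ hl, ← hf.map_eq, mgf_map hf.aemeasurable]
  · rfl
  · have : Measurable fun w : Fin (Module.finrank ℂ W) → ℂ =>
        Real.exp (-l * ∑ i, ‖w i‖ ^ 2) := by fun_prop
    exact this.aestronglyMeasurable

theorem integrable_exp_norm_sq_starProjection {σ : ℝ} (hσ : 0 < σ) {l : ℝ}
    (hl : 0 < 1 + l * σ ^ 2) {N : ℕ} (W : Submodule ℂ (EuclideanSpace ℂ (Fin N))) :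
    Integrable (fun w => Real.exp (-l * ‖W.starProjection (WithLp.toLp 2 w)‖ ^ 2))
      (noiseLaw σ N) := by
  -- The integral of a non-integrable function is 0 by convention, so the nonzero value of the mgf
  -- forces integrability.
  refine Integrable.of_integral_ne_zero ?_
  have := mgf_norm_sq_starProjection hσ hl W
  rw [mgf] at this
  rw [this]
  positivity

/-- Lower tail of the squared norm of the projection of a Gaussian vector. -/
theorem measureReal_norm_sq_starProjection_le {σ : ℝ} (hσ : 0 < σ) {N : ℕ}
    (W : Submodule ℂ (EuclideanSpace ℂ (Fin N))) {s : ℝ} (hs : 0 ≤ s) :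
    (noiseLaw σ N).real {w | ‖W.starProjection (WithLp.toLp 2 w)‖ ^ 2 ≤
        Module.finrank ℂ W * (σ ^ 2 * (1 - s))} ≤
      Real.exp (-(Module.finrank ℂ W * (s ^ 2 / 2))) := by
  set d := Module.finrank ℂ W
  have hu : s / σ ^ 2 * σ ^ 2 = s := by field_simp
  have hl : 0 < 1 + s / σ ^ 2 * σ ^ 2 := by rw [hu]; linarith
  -- With this tilt the exponent is `d * (s * (1 - s) - log (1 + s))`, and `log (1 + s) ≥ s - s² /
  -- 2`.
  refine (measure_le_le_exp_mul_mgf (t := -(s / σ ^ 2)) _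
    (neg_nonpos.2 (by positivity)) (integrable_exp_norm_sq_starProjection hσ hl W)).trans ?_
  rw [mgf_norm_sq_starProjection hσ hl, hu]
  have h1 : (1 + s)⁻¹ = Real.exp (-Real.log (1 + s)) := by
    rw [Real.exp_neg, Real.exp_log (by linarith)]
  rw [h1, ← Real.exp_nat_mul, ← Real.exp_add, Real.exp_le_exp]
  have h2 : s - s ^ 2 / 2 ≤ Real.log (1 + s) := by
    refine le_trans ?_ (Real.le_log_one_add_of_nonneg hs)
    rw [le_div_iff₀ (by linarith)]
    nlinarith [pow_nonneg hs 3]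
  have h3 : -(-(s / σ ^ 2)) * (d * (σ ^ 2 * (1 - s))) = d * (s * (1 - s)) := by
    field_simp
  rw [h3]
  have : (d : ℝ) * (s - s ^ 2 / 2) ≤ d * Real.log (1 + s) := by gcongr
  linarith

/-- Upper tail of the squared norm of the projection of a Gaussian vector. -/
theorem measureReal_le_norm_sq_starProjection {σ : ℝ} (hσ : 0 < σ) {N : ℕ}
    (W : Submodule ℂ (EuclideanSpace ℂ (Fin N))) {t : ℝ} (ht : 0 ≤ t) (ht1 : t ≤ 1) :
    (noiseLaw σ N).real {w | Module.finrank ℂ W * (σ ^ 2 * (1 + t)) ≤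
        ‖W.starProjection (WithLp.toLp 2 w)‖ ^ 2} ≤
      Real.exp (-(Module.finrank ℂ W * (t ^ 2 / 8))) := by
  set d := Module.finrank ℂ W
  have hu : -(t / 4 / σ ^ 2) * σ ^ 2 = -(t / 4) := by field_simp
  have hl : 0 < 1 + -(t / 4 / σ ^ 2) * σ ^ 2 := by rw [hu]; linarith
  have hi := integrable_exp_norm_sq_starProjection hσ hl W
  have hm := mgf_norm_sq_starProjection hσ hl W
  rw [neg_neg] at hm
  simp only [neg_neg] at hi
  -- The tilt `t / 4` keeps `1 - t / 4` away from 0. The exponent is `-d * (t / 4 * (1 + t) + log (1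
  -- - t / 4))`, and `log (1 - t / 4) ≥ -t / 4 - t² / 8`.
  refine (measure_ge_le_exp_mul_mgf (t := t / 4 / σ ^ 2) _ (by positivity) hi).trans ?_
  rw [hm, hu]
  have hp : 0 < 1 + -(t / 4) := by linarith
  have h1 : (1 + -(t / 4))⁻¹ = Real.exp (-Real.log (1 + -(t / 4))) := by
    rw [Real.exp_neg, Real.exp_log hp]
  rw [h1, ← Real.exp_nat_mul, ← Real.exp_add, Real.exp_le_exp]
  have h2 : -(t / 4) - t ^ 2 / 8 ≤ Real.log (1 + -(t / 4)) := by
    refine le_trans ?_ (Real.one_sub_inv_le_log_of_pos hp)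
    rw [le_sub_iff_add_le, ← le_sub_iff_add_le', inv_le_iff_one_le_mul₀ hp]
    nlinarith [sq_nonneg t]
  have h3 : -(t / 4 / σ ^ 2) * (d * (σ ^ 2 * (1 + t))) = -(d * (t / 4 * (1 + t))) := by
    field_simp
  rw [h3]
  have : (d : ℝ) * (-(t / 4) - t ^ 2 / 8) ≤ d * Real.log (1 + -(t / 4)) := by gcongr
  linarith

end SparseRecovery
-- Column spans: measurability, generic rank, and the residual.
namespace SparseRecovery

variable {N : ℕ} {ι : Type*} [Fintype ι]

/-- The subspace of `ℂ^N` spanned by the columns of an array of entries. -/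
noncomputable def colSpan {N : ℕ} {ι : Type*} (B : Fin N → ι → ℂ) :
    Submodule ℂ (EuclideanSpace ℂ (Fin N)) :=
  Submodule.span ℂ (Set.range fun j : ι => WithLp.toLp 2 fun r => B r j)

theorem mem_colSpan_iff {B : Fin N → ι → ℂ} {v : EuclideanSpace ℂ (Fin N)} :
    v ∈ colSpan B ↔ ∃ c : ι → ℂ, WithLp.toLp 2 (fun r => ∑ j, B r j * c j) = v := by
  rw [colSpan, Submodule.mem_span_range_iff_exists_fun]
  refine exists_congr fun c => ?_
  have : ∑ j, c j • WithLp.toLp 2 (fun r => B r j) =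
      WithLp.toLp 2 (fun r => ∑ j, B r j * c j) := by
    ext r
    simp [mul_comm]
  rw [this]

theorem norm_starProjection_colSpan_orthogonal (B : Fin N → ι → ℂ) (w : Fin N → ℂ) :
    ‖(colSpan B)ᗮ.starProjection (WithLp.toLp 2 w)‖ =
      ⨅ c : ι → ℂ, ‖WithLp.toLp 2 (fun r => w r - ∑ j, B r j * c j)‖ := by
  rw [Submodule.starProjection_orthogonal', sub_apply,
    one_apply_eq_self, Submodule.starProjection_minimal]
  have hs : Function.Surjective (fun c : ι → ℂ =>
      (⟨WithLp.toLp 2 (fun r => ∑ j, B r j * c j), mem_colSpan_iff.2 ⟨c, rfl⟩⟩ : colSpan B)) := by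
    rintro ⟨v, hv⟩
    obtain ⟨c, hc⟩ := mem_colSpan_iff.1 hv
    exact ⟨c, Subtype.ext hc⟩
  rw [← hs.iInf_comp]
  rfl

/-- The distance to the span need not be continuous where the rank drops. As an infimum over
coefficients of jointly continuous functions, it is still upper semicontinuous. -/
theorem measurable_norm_starProjection_colSpan_orthogonal :
    Measurable fun p : (Fin N → ι → ℂ) × (Fin N → ℂ) =>
      ‖(colSpan p.1)ᗮ.starProjection (WithLp.toLp 2 p.2)‖ := by
  simp_rw [norm_starProjection_colSpan_orthogonal]
  refine UpperSemicontinuous.measurable (upperSemicontinuous_ciInf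
    (fun p => ⟨0, ?_⟩) fun c => Continuous.upperSemicontinuous ?_)
  · rintro _ ⟨c, rfl⟩
    exact norm_nonneg _
  · fun_prop

theorem finrank_colSpan_eq_iff (B : Fin N → ι → ℂ) :
    Module.finrank ℂ (colSpan B) = Fintype.card ι ↔
      LinearIndependent ℂ fun j : ι => WithLp.toLp 2 fun r => B r j := by
  rw [linearIndependent_iff_card_eq_finrank_span, eq_comm]
  rfl

theorem measurableSet_finrank_colSpan_eq :
    MeasurableSet {B : Fin N → ι → ℂ | Module.finrank ℂ (colSpan B) = Fintype.card ι} := by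
  simp_rw [finrank_colSpan_eq_iff]
  have hc : Continuous fun (B : Fin N → ι → ℂ) (j : ι) => WithLp.toLp 2 fun r => B r j := by
    fun_prop
  exact (isOpen_setOfPred_linearIndependent.preimage hc).measurableSet

theorem finrank_colSpan_orthogonal {ι : Type*} (B : Fin N → ι → ℂ) :
    Module.finrank ℂ (colSpan B)ᗮ = N - Module.finrank ℂ (colSpan B) := by
  have := (colSpan B).finrank_add_finrank_orthogonal
  rw [finrank_euclideanSpace_fin] at this
  omega

theorem norm_starProjection_orthogonal_eq_zero_iff
    {W : Submodule ℂ (EuclideanSpace ℂ (Fin N))} {v : EuclideanSpace ℂ (Fin N)} :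
    ‖Wᗮ.starProjection v‖ = 0 ↔ v ∈ W := by
  rw [norm_eq_zero, Submodule.starProjection_apply_eq_zero_iff, Submodule.orthogonal_orthogonal]

theorem complexGaussian_singleton_zero {σ : ℝ} (hσ : 0 < σ) : complexGaussian σ {0} = 0 := by
  have hv : Real.toNNReal (σ ^ 2 / 2) ≠ 0 := by
    rw [Ne, Real.toNNReal_eq_zero]
    have : 0 < σ ^ 2 / 2 := by positivity
    linarith
  have := nullSingletonClass_gaussianReal (μ := 0) hv
  rw [complexGaussian, MeasurableEquiv.map_apply]
  refine measure_mono_null (t := {(0 : ℝ)} ×ˢ Set.univ) ?_ ?_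
  · intro p hp
    have := congrArg Complex.re (Set.mem_singleton_iff.1 hp)
    simpa using this
  · rw [Measure.prod_prod]
    simp

/-- On this event a Gaussian coordinate along a unit vector of `Wᗮ` vanishes, and its law has no
atom at 0. -/
theorem noiseLaw_proper_subspace {σ : ℝ} (hσ : 0 < σ)
    {W : Submodule ℂ (EuclideanSpace ℂ (Fin N))} (hW : 0 < Module.finrank ℂ Wᗮ) :
    noiseLaw σ N {w | WithLp.toLp 2 w ∈ W} = 0 := by
  obtain ⟨f, hf, h⟩ := exists_measurePreserving_starProjection σ Wᗮ
  have he := (measurePreserving_eval (fun _ : Fin (Module.finrank ℂ Wᗮ) => complexGaussian σ)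
    ⟨0, hW⟩).comp hf
  refine measure_mono_null (t := (Function.eval ⟨0, hW⟩ ∘ f) ⁻¹' {0}) ?_ ?_
  · intro w hw
    have hw0 := norm_starProjection_orthogonal_eq_zero_iff.2 hw
    have h0 := h w
    rw [hw0, eq_comm, zero_pow two_ne_zero,
      Finset.sum_eq_zero_iff_of_nonneg fun _ _ => by positivity] at h0
    simpa using h0 ⟨0, hW⟩ (Finset.mem_univ _)
  · rw [he.measure_preimage (measurableSet_singleton _).nullMeasurableSet,
      complexGaussian_singleton_zero hσ]

/-- Taking `z = Pi.single j 1` in `measurePreserving_columns` makes column `j` a Gaussian vector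
independent of the columns in `J.erase j`, whose span has dimension below `N`. -/
theorem ae_notMem_colSpan_erase {M : ℕ} {J : Finset (Fin M)} (hJ : J.card ≤ N) {j : Fin M}
    (hj : j ∈ J) : ∀ᵐ A ∂(matrixLaw N M),
      WithLp.toLp 2 (fun r => A r j) ∉ colSpan fun r (i : J.erase j) => A r i := by
  have hz : (1 : ℝ) ^ 2 = ∑ i : {i // i ∉ J.erase j}, ‖(Pi.single j 1 : Fin M → ℂ) i‖ ^ 2 := by
    rw [Finset.sum_eq_single ⟨j, Finset.notMem_erase j J⟩]
    · simp
    · rintro ⟨i, hi⟩ _ hne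
      have : i ≠ j := fun h => hne (Subtype.ext h)
      simp [this]
    · simp
  have hmp := measurePreserving_columns N (J.erase j) (Pi.single j 1) hz
  set S : Set ((Fin N → J.erase j → ℂ) × (Fin N → ℂ)) :=
    {p | ‖(colSpan p.1)ᗮ.starProjection (WithLp.toLp 2 p.2)‖ = 0}
  have hS : MeasurableSet S :=
    measurable_norm_starProjection_colSpan_orthogonal (measurableSet_singleton 0)
  have hS0 : ((Measure.pi fun _ : Fin N => Measure.pi fun _ : J.erase j =>
      complexGaussian 1).prod (noiseLaw 1 N)) S = 0 := by
    rw [Measure.measure_prod_null hS]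
    refine ae_of_all _ fun B => ?_
    have : 0 < Module.finrank ℂ (colSpan B)ᗮ := by
      have h1 : Module.finrank ℂ (colSpan B) ≤ Fintype.card (J.erase j) :=
        finrank_range_le_card _
      rw [Fintype.card_coe, Finset.card_erase_of_mem hj] at h1
      have h2 : 0 < J.card := Finset.card_pos.2 ⟨j, hj⟩
      rw [finrank_colSpan_orthogonal]
      omega
    refine measure_mono_null ?_ (noiseLaw_proper_subspace one_pos this)
    intro w hw
    exact norm_starProjection_orthogonal_eq_zero_iff.1 hw
  rw [← hmp.measure_preimage hS.nullMeasurableSet] at hS0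
  refine measure_mono_null ?_ hS0
  intro A hA
  have hA : WithLp.toLp 2 (fun r => A r j) ∈ colSpan fun r (i : J.erase j) => A r i := by
    simpa using hA
  have hw : (fun r => ∑ i : {i // i ∉ J.erase j}, A r i * (Pi.single j 1 : Fin M → ℂ) i) =
      fun r => A r j := by
    ext r
    rw [Finset.sum_eq_single ⟨j, Finset.notMem_erase j J⟩]
    · simp
    · rintro ⟨i, hi⟩ _ hne
      have : i ≠ j := fun h => hne (Subtype.ext h)
      simp [this]
    · simp
  simp only [S, Set.mem_preimage, Set.mem_ofPred_eq, hw]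
  exact norm_starProjection_orthogonal_eq_zero_iff.2 hA

theorem ae_finrank_colSpan_eq {M : ℕ} {J : Finset (Fin M)} (hJ : J.card ≤ N) :
    ∀ᵐ A ∂(matrixLaw N M), Module.finrank ℂ (colSpan fun r (j : J) => A r j) = J.card := by
  have h : ∀ᵐ A ∂(matrixLaw N M), ∀ j : J,
      WithLp.toLp 2 (fun r => A r j) ∉ colSpan fun r (i : J.erase j) => A r i :=
    ae_all_iff.2 fun j => ae_notMem_colSpan_erase hJ j.2
  filter_upwards [h] with A hA
  rw [← Fintype.card_coe, finrank_colSpan_eq_iff, linearIndependent_iff_notMem_span]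
  refine fun j hj => hA j (Submodule.span_mono ?_ hj)
  rintro _ ⟨i, hi, rfl⟩
  have : (i : Fin M) ≠ j := fun h => hi.2 (Subtype.ext h)
  exact ⟨⟨i, Finset.mem_erase.2 ⟨this, i.2⟩⟩, rfl⟩

theorem rank_columns {M : ℕ} (A : Matrix (Fin N) (Fin M) ℂ) (J : Finset (Fin M)) :
    (columns A J).rank = Module.finrank ℂ (colSpan fun r (j : J) => A r j) := by
  rw [Matrix.rank_eq_finrank_span_cols, colSpan,
    ← LinearEquiv.finrank_map_eq (WithLp.linearEquiv 2 ℂ (Fin N → ℂ)).symm, Submodule.map_span,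
    ← Set.range_comp]
  rfl

/-- The columns in `J` contribute to `A x` a vector of their own span, which the projection kills.
-/
theorem residual_mulVec_add {M : ℕ} (A : Matrix (Fin N) (Fin M) ℂ) (J : Finset (Fin M))
    (x : Fin M → ℂ) (n : Fin N → ℂ) :
    residual A J (A *ᵥ x + n) =
      ‖(colSpan fun r (j : J) => A r j)ᗮ.starProjection
        (WithLp.toLp 2 fun r => (∑ i : {i // i ∉ J}, A r i * x i) + n r)‖ ^ 2 := by
  have h : WithLp.toLp 2 (A *ᵥ x + n) = WithLp.toLp 2 (fun r => ∑ j : J, A r j * x j) +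
      WithLp.toLp 2 fun r => (∑ i : {i // i ∉ J}, A r i * x i) + n r := by
    ext r
    simp only [PiLp.add_apply, Pi.add_apply, Matrix.mulVec, dotProduct]
    rw [← add_assoc]
    congr 1
    convert! (Fintype.sum_subtype_add_sum_subtype (· ∈ J) fun i => A r i * x i).symm
  have h0 : (colSpan fun r (j : J) => A r j)ᗮ.starProjection
      (WithLp.toLp 2 (fun r => ∑ j : J, A r j * x j)) = 0 := by
    rw [← norm_eq_zero, norm_starProjection_orthogonal_eq_zero_iff]
    exact mem_colSpan_iff.2 ⟨fun j => x j, rfl⟩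
  rw [residual, h, map_add]
  erw [h0]
  rw [zero_add]
  rfl

end SparseRecovery
-- Typicality events and the union bound.
namespace SparseRecovery

variable {N M : ℕ}

/-- The variance per coordinate of the part of the observation `A x + n` that is independent of the
columns of `A` with index in `J`. -/
noncomputable def effectiveVariance (ν : ℝ) (x : Fin M → ℂ) (J : Finset (Fin M)) : ℝ :=
  (∑ i : {i // i ∉ J}, ‖x i‖ ^ 2) + ν ^ 2

theorem effectiveVariance_supp (ν : ℝ) (x : Fin M → ℂ) :
    effectiveVariance ν x (supp x) = ν ^ 2 := by
  rw [effectiveVariance, Finset.sum_eq_zero, zero_add]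
  rintro ⟨i, hi⟩ _
  have : x i = 0 := by simpa [supp] using hi
  simp [this]

/-- The columns of `A` with index in `J`, and the part of the observation that is independent
of them. -/
noncomputable def splitObservation (N : ℕ) (x : Fin M → ℂ) (J : Finset (Fin M))
    (p : (Fin N → Fin M → ℂ) × (Fin N → ℂ)) : (Fin N → J → ℂ) × (Fin N → ℂ) :=
  ((fun r (j : J) => p.1 r j), fun r => (∑ i : {i // i ∉ J}, p.1 r i * x i) + p.2 r)

theorem measurable_splitObservation (N : ℕ) (x : Fin M → ℂ) (J : Finset (Fin M)) :
    Measurable (splitObservation N x J) := by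
  unfold splitObservation
  fun_prop

/-- Fubini: by independence, a bound uniform in the frozen columns `B` passes to the joint law. -/
theorem measure_preimage_splitObservation_le {ν : ℝ} (hν : 0 < ν) (x : Fin M → ℂ)
    (J : Finset (Fin M)) {S : Set ((Fin N → J → ℂ) × (Fin N → ℂ))} (hS : MeasurableSet S)
    {c : ENNReal}
    (h : ∀ τ, 0 < τ → τ ^ 2 = effectiveVariance ν x J →
      ∀ B, noiseLaw τ N {w | (B, w) ∈ S} ≤ c) :
    ((matrixLaw N M).prod (noiseLaw ν N)) (splitObservation N x J ⁻¹' S) ≤ c := by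
  have hpos : 0 < effectiveVariance ν x J := by unfold effectiveVariance; positivity
  have hτ := Real.sq_sqrt hpos.le
  have hmp := measurePreserving_columns_noise N J x hτ
  refine (hmp.measure_preimage hS.nullMeasurableSet).trans_le ?_
  rw [Measure.prod_apply hS]
  refine (lintegral_mono fun B => h _ (Real.sqrt_pos.2 hpos) hτ B).trans ?_
  simp

/-- The arrays of `J` independent columns and the vectors whose distance to the span of these
columns satisfies `P`. -/
def distanceEvent (N : ℕ) (J : Finset (Fin M)) (P : ℝ → Prop) :
    Set ((Fin N → J → ℂ) × (Fin N → ℂ)) :=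
  {q | Module.finrank ℂ (colSpan q.1) = J.card ∧
    P (‖(colSpan q.1)ᗮ.starProjection (WithLp.toLp 2 q.2)‖ ^ 2)}

theorem measurableSet_distanceEvent (N : ℕ) (J : Finset (Fin M)) {P : ℝ → Prop}
    (hP : MeasurableSet {r | P r}) : MeasurableSet (distanceEvent N J P) := by
  have h := measurableSet_finrank_colSpan_eq (N := N) (ι := J)
  rw [Fintype.card_coe] at h
  exact (measurable_fst h).inter
    ((measurable_norm_starProjection_colSpan_orthogonal.pow_const 2) hP)

theorem mem_preimage_distanceEvent_iff {x : Fin M → ℂ} {J : Finset (Fin M)} {P : ℝ → Prop}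
    {p : (Fin N → Fin M → ℂ) × (Fin N → ℂ)} :
    p ∈ splitObservation N x J ⁻¹' distanceEvent N J P ↔
      (columns (Matrix.of p.1) J).rank = J.card ∧
        P (residual (Matrix.of p.1) J (Matrix.of p.1 *ᵥ x + p.2)) := by
  rw [rank_columns, residual_mulVec_add]
  rfl

theorem measure_distanceEvent_le {ν : ℝ} (hν : 0 < ν) (x : Fin M → ℂ) (J : Finset (Fin M))
    {P : ℝ → Prop} (hP : MeasurableSet {r | P r}) {c : ℝ}
    (h : ∀ τ, 0 < τ → τ ^ 2 = effectiveVariance ν x J →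
      ∀ W : Submodule ℂ (EuclideanSpace ℂ (Fin N)), Module.finrank ℂ W = N - J.card →
        (noiseLaw τ N).real {w | P (‖W.starProjection (WithLp.toLp 2 w)‖ ^ 2)} ≤ c) :
    ((matrixLaw N M).prod (noiseLaw ν N)) (splitObservation N x J ⁻¹' distanceEvent N J P) ≤
      ENNReal.ofReal c := by
  refine measure_preimage_splitObservation_le hν x J (measurableSet_distanceEvent N J hP) ?_
  intro τ hτ hτ2 B
  -- Full rank fixes the dimension of the complement at `N - J.card`; otherwise the section of the
  -- event is empty.
  by_cases hB : Module.finrank ℂ (colSpan B) = J.card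
  · have := h τ hτ hτ2 (colSpan B)ᗮ (by rw [finrank_colSpan_orthogonal, hB])
    have hsub : {w | (B, w) ∈ distanceEvent N J P} ⊆
        {w | P (‖(colSpan B)ᗮ.starProjection (WithLp.toLp 2 w)‖ ^ 2)} := fun w hw => hw.2
    refine (measure_mono hsub).trans ?_
    rw [← ofReal_measureReal]
    exact ENNReal.ofReal_le_ofReal this
  · have : {w | (B, w) ∈ distanceEvent N J P} = ∅ :=
      Set.eq_empty_of_forall_notMem fun w hw => hB hw.1
    simp [this]

theorem measure_distanceEvent_lower_le {ν : ℝ} (hν : 0 < ν) (x : Fin M → ℂ) (J : Finset (Fin M))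
    {s thr : ℝ} (hs : 0 ≤ s)
    (hthr : thr ≤ (N - J.card : ℕ) * (effectiveVariance ν x J * (1 - s))) :
    ((matrixLaw N M).prod (noiseLaw ν N))
        (splitObservation N x J ⁻¹' distanceEvent N J fun r => r ≤ thr) ≤
      ENNReal.ofReal (Real.exp (-((N - J.card : ℕ) * (s ^ 2 / 2)))) := by
  refine measure_distanceEvent_le hν x J measurableSet_Iic fun τ hτ hτ2 W hW => ?_
  rw [← hW]
  refine (measureReal_mono fun w hw => ?_).trans (measureReal_norm_sq_starProjection_le hτ W hs)
  have hw : ‖W.starProjection (WithLp.toLp 2 w)‖ ^ 2 ≤ thr := hw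
  simp only [Set.mem_ofPred_eq]
  rw [hW, hτ2]
  exact hw.trans hthr

theorem measure_distanceEvent_upper_le {ν : ℝ} (hν : 0 < ν) (x : Fin M → ℂ) (J : Finset (Fin M))
    {t thr : ℝ} (ht : 0 ≤ t) (ht1 : t ≤ 1)
    (hthr : (N - J.card : ℕ) * (effectiveVariance ν x J * (1 + t)) ≤ thr) :
    ((matrixLaw N M).prod (noiseLaw ν N))
        (splitObservation N x J ⁻¹' distanceEvent N J fun r => thr ≤ r) ≤
      ENNReal.ofReal (Real.exp (-((N - J.card : ℕ) * (t ^ 2 / 8)))) := by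
  refine measure_distanceEvent_le hν x J measurableSet_Ici fun τ hτ hτ2 W hW => ?_
  rw [← hW]
  refine (measureReal_mono fun w hw => ?_).trans
    (measureReal_le_norm_sq_starProjection hτ W ht ht1)
  have hw : thr ≤ ‖W.starProjection (WithLp.toLp 2 w)‖ ^ 2 := hw
  simp only [Set.mem_ofPred_eq]
  rw [hW, hτ2]
  exact hthr.trans hw

theorem jointTypicalityDecoder_eq {ν δ : ℝ} {L : ℕ} {A : Matrix (Fin N) (Fin M) ℂ}
    {y : Fin N → ℂ} {I : Finset (Fin M)} (hI : JointlyTypical ν δ L A y I)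
    (h : ∀ J, JointlyTypical ν δ L A y J → J = I) : jointTypicalityDecoder N M ν δ L A y = I := by
  have he : ∃! J : Finset (Fin M), JointlyTypical ν δ L A y J := ⟨I, hI, h⟩
  rw [jointTypicalityDecoder, dif_pos he]
  exact h _ he.choose_spec.1

theorem abs_residual_sub_lt_iff {d : ℕ} {ν δ r : ℝ} (hN : 0 < N) {L : ℕ} (hd : N = d + L) :
    |1 / (N : ℝ) * r - ((N : ℝ) - L) / N * ν ^ 2| < δ ↔ |r - d * ν ^ 2| < N * δ := by
  have hN' : (0 : ℝ) < N := by exact_mod_cast hN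
  have hd' : (N : ℝ) - L = d := by rw [hd]; push_cast; ring
  have : 1 / (N : ℝ) * r - ((N : ℝ) - L) / N * ν ^ 2 = (r - d * ν ^ 2) / N := by
    rw [hd']; ring
  rw [this, abs_div, abs_of_pos hN', div_lt_iff₀ hN', mul_comm δ]

/-- Union bound for the error probability of the joint-typicality decoder. -/
theorem errorProb_le {ν δ : ℝ} (hν : 0 < ν) (x : Fin M → ℂ) (hN : 0 < N) {d : ℕ}
    (hd : N = d + sparsity x) {t : ℝ} (ht : 0 ≤ t) (ht1 : t ≤ 1) (htδ : d * (ν ^ 2 * t) ≤ N * δ)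
    {s : Finset (Fin M) → ℝ}
    (hs : ∀ J, J.card = sparsity x → J ≠ supp x → 0 ≤ s J ∧
      d * ν ^ 2 + N * δ ≤ d * (effectiveVariance ν x J * (1 - s J))) :
    errorProb (jointTypicalityDecoder N M ν δ (sparsity x)) ν x ≤
      2 * ENNReal.ofReal (Real.exp (-(d * (t ^ 2 / 8)))) +
        ∑ J ∈ (Finset.powersetCard (sparsity x) Finset.univ).erase (supp x),
          ENNReal.ofReal (Real.exp (-(d * (s J ^ 2 / 2)))) := by
  set L := sparsity x
  set I := supp x
  have hIL : I.card = L := rfl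
  have hNL : N - L = d := by omega
  set F := (Finset.powersetCard L (Finset.univ : Finset (Fin M))).erase I
  have hF {J : Finset (Fin M)} : J ∈ F ↔ J ≠ I ∧ J.card = L := by
    simp [F, Finset.mem_powersetCard]
  set U := splitObservation N x I ⁻¹' distanceEvent N I fun r => d * ν ^ 2 + N * δ ≤ r
  set V := splitObservation N x I ⁻¹' distanceEvent N I fun r => r ≤ d * ν ^ 2 - N * δ
  -- `U` and `V` are the two ways the support can miss the residual window. For a wrong set only the
  -- upper edge of the window matters, since its residual is typically too large.
  set E : Finset (Fin M) → Set ((Fin N → Fin M → ℂ) × (Fin N → ℂ)) := fun J =>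
    splitObservation N x J ⁻¹' distanceEvent N J fun r => r ≤ d * ν ^ 2 + N * δ
  have hU : MeasurableSet U :=
    measurable_splitObservation N x I (measurableSet_distanceEvent N I measurableSet_Ici)
  have hV : MeasurableSet V :=
    measurable_splitObservation N x I (measurableSet_distanceEvent N I measurableSet_Iic)
  have hE (J : Finset (Fin M)) : MeasurableSet (E J) :=
    measurable_splitObservation N x J (measurableSet_distanceEvent N J measurableSet_Iic)
  have hT : MeasurableSet ((U ∪ V) ∪ ⋃ J ∈ F, E J) :=
    (hU.union hV).union (F.measurableSet_biUnion fun J _ => hE J)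
  have hmain : errorProb (jointTypicalityDecoder N M ν δ L) ν x ≤
      ((matrixLaw N M).prod (noiseLaw ν N)) ((U ∪ V) ∪ ⋃ J ∈ F, E J) := by
    rw [errorProb, Measure.prod_apply hT]
    refine lintegral_mono_ae ?_
    -- The rank condition for the true support costs no probability.
    filter_upwards [ae_finrank_colSpan_eq (N := N) (J := I) (by omega)] with A hA
    refine measure_mono fun n hn => ?_
    by_contra hnot
    refine hn ?_
    simp only [Set.mem_preimage, Set.mem_union, Set.mem_iUnion, not_or, not_exists] at hnot
    obtain ⟨⟨hnU, hnV⟩, hnE⟩ := hnot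
    have hrank : (columns (Matrix.of A) I).rank = I.card := by rw [rank_columns]; exact hA
    have hnU' := not_le.1 fun h => hnU (mem_preimage_distanceEvent_iff.2 ⟨hrank, h⟩)
    have hnV' := not_le.1 fun h => hnV (mem_preimage_distanceEvent_iff.2 ⟨hrank, h⟩)
    refine jointTypicalityDecoder_eq ⟨hIL, hrank, ?_⟩ ?_
    · rw [abs_residual_sub_lt_iff hN hd, abs_lt]
      exact ⟨by linarith, by linarith⟩
    · rintro J ⟨hJ, hJr, hJt⟩
      by_contra hne
      refine hnE J (hF.2 ⟨hne, hJ⟩) (mem_preimage_distanceEvent_iff.2 ⟨hJr.trans hJ.symm, ?_⟩)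
      rw [abs_residual_sub_lt_iff hN hd, abs_lt] at hJt
      simp only
      linarith [hJt.2]
  have hPU : ((matrixLaw N M).prod (noiseLaw ν N)) U ≤
      ENNReal.ofReal (Real.exp (-(d * (t ^ 2 / 8)))) := by
    have := measure_distanceEvent_upper_le (N := N) (thr := d * ν ^ 2 + N * δ) hν x I ht ht1 (by
      rw [effectiveVariance_supp, hIL, hNL]; linarith)
    rwa [hIL, hNL] at this
  have hPV : ((matrixLaw N M).prod (noiseLaw ν N)) V ≤
      ENNReal.ofReal (Real.exp (-(d * (t ^ 2 / 8)))) := by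
    have := measure_distanceEvent_lower_le (N := N) (thr := d * ν ^ 2 - N * δ) hν x I ht (by
      rw [effectiveVariance_supp, hIL, hNL]; linarith)
    rw [hIL, hNL] at this
    refine this.trans (ENNReal.ofReal_le_ofReal (Real.exp_le_exp.2 ?_))
    gcongr
    norm_num
  have hPE (J : Finset (Fin M)) (hJ : J ∈ F) : ((matrixLaw N M).prod (noiseLaw ν N)) (E J) ≤
      ENNReal.ofReal (Real.exp (-(d * (s J ^ 2 / 2)))) := by
    obtain ⟨hne, hJL⟩ := hF.1 hJ
    obtain ⟨hs0, hs1⟩ := hs J hJL hne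
    have := measure_distanceEvent_lower_le (N := N) (thr := d * ν ^ 2 + N * δ) hν x J hs0 (by
      rw [hJL, hNL]; exact hs1)
    rwa [hJL, hNL] at this
  refine hmain.trans ((measure_union_le _ _).trans (add_le_add ?_ ?_))
  · rw [two_mul]
    exact (measure_union_le _ _).trans (add_le_add hPU hPV)
  · exact (measure_biUnion_finset_le _ _).trans (Finset.sum_le_sum hPE)

end SparseRecovery
-- Counting wrong supports and the explicit error bound.
namespace SparseRecovery

theorem card_symmDiff_of_card_eq {α : Type*} [DecidableEq α] {I J : Finset α}
    (h : J.card = I.card) : (symmDiff I J).card = 2 * (I \ J).card := by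
  have hd : Disjoint (I \ J) (J \ I) := disjoint_sdiff_sdiff
  have hu : symmDiff I J = (I \ J) ∪ (J \ I) := rfl
  have := Finset.card_sdiff_comm h
  rw [hu, Finset.card_union_of_disjoint hd]
  omega

/-- The map `J ↦ symmDiff I J` is injective and sends the wrong sets to nonempty sets of size `2 *
(I \ J).card`. Enlarging to all nonempty sets gives `(1 + a)^M - 1`, with no estimate of binomial
coefficients. -/
theorem sum_pow_card_sdiff_le {M : ℕ} (I : Finset (Fin M)) {a : ℝ} (ha : 0 ≤ a) :
    ∑ J ∈ (Finset.powersetCard I.card Finset.univ).erase I, a ^ (2 * (I \ J).card) ≤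
      Real.exp (M * a) - 1 := by
  have h1 : ∑ J ∈ (Finset.powersetCard I.card Finset.univ).erase I, a ^ (2 * (I \ J).card) =
      ∑ S ∈ ((Finset.powersetCard I.card Finset.univ).erase I).image (symmDiff I),
        a ^ S.card := by
    rw [Finset.sum_image fun _ _ _ _ h => symmDiff_right_injective I h]
    refine Finset.sum_congr rfl fun J hJ => ?_
    rw [card_symmDiff_of_card_eq]
    simpa [Finset.mem_powersetCard] using (Finset.mem_erase.1 hJ).2
  have h2 : ∑ S ∈ (Finset.univ : Finset (Finset (Fin M))).erase ∅, a ^ S.card =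
      (a + 1) ^ M - 1 := by
    have h := Fintype.sum_pow_mul_eq_add_pow (Fin M) a 1
    simp only [one_pow, mul_one, Fintype.card_fin] at h
    rw [← h, ← Finset.add_sum_erase _ _ (Finset.mem_univ ∅), Finset.card_empty, pow_zero]
    ring
  rw [h1]
  calc _ ≤ ∑ S ∈ (Finset.univ : Finset (Finset (Fin M))).erase ∅, a ^ S.card := by
        refine Finset.sum_le_sum_of_subset_of_nonneg ?_ fun _ _ _ => by positivity
        intro S hS
        obtain ⟨J, hJ, rfl⟩ := Finset.mem_image.1 hS
        refine Finset.mem_erase.2 ⟨fun h => (Finset.mem_erase.1 hJ).1 ?_, Finset.mem_univ _⟩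
        exact (symmDiff_eq_bot.1 h).symm
    _ = (a + 1) ^ M - 1 := h2
    _ ≤ Real.exp (M * a) - 1 := by
        rw [Real.exp_nat_mul]
        gcongr
        exact Real.add_one_le_exp a

theorem minMagnitude_nonneg {M : ℕ} (x : Fin M → ℂ) : 0 ≤ minMagnitude x :=
  Real.iInf_nonneg fun _ => norm_nonneg _

theorem minMagnitude_le {M : ℕ} {x : Fin M → ℂ} {i : Fin M} (hi : i ∈ supp x) :
    minMagnitude x ≤ ‖x i‖ :=
  ciInf_le (f := fun i : supp x => ‖x i‖) (Set.finite_range _).bddBelow ⟨i, hi⟩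

theorem le_effectiveVariance {M : ℕ} (ν : ℝ) (x : Fin M → ℂ) (J : Finset (Fin M)) :
    ν ^ 2 + (supp x \ J).card * minMagnitude x ^ 2 ≤ effectiveVariance ν x J := by
  have h : ∑ i : {i // i ∉ J}, ‖x i‖ ^ 2 = ∑ i ∈ Finset.univ \ J, ‖x i‖ ^ 2 :=
    (Finset.sum_subtype (Finset.univ \ J) (by simp) fun i => ‖x i‖ ^ 2).symm
  rw [effectiveVariance, h, add_comm]
  gcongr
  calc _ = ∑ i ∈ supp x \ J, minMagnitude x ^ 2 := by rw [Finset.sum_const, nsmul_eq_mul]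
    _ ≤ ∑ i ∈ supp x \ J, ‖x i‖ ^ 2 := by
        refine Finset.sum_le_sum fun i hi => ?_
        have := minMagnitude_le (Finset.mem_sdiff.1 hi).1
        have := minMagnitude_nonneg x
        gcongr
    _ ≤ _ := Finset.sum_le_sum_of_subset_of_nonneg
        (Finset.sdiff_subset_sdiff (Finset.subset_univ _) subset_rfl) fun _ _ _ => by positivity

/-- The relative energy gap caused by `k` missed indices. -/
theorem le_sq_energy_gap {k L m ν : ℝ} (hν : 0 < ν) (hm : 0 ≤ m) (hk : 1 ≤ k) (hkL : k ≤ L)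
    (hL : ν ^ 4 ≤ L * m ^ 2) : k ≤ 16 * L * (k * m / 2 / (ν ^ 2 + k * m)) ^ 2 := by
  have hkm : 0 ≤ k * m := by positivity
  -- If the missed energy dominates the noise, the gap is at least `1/4` and `k ≤ L` suffices.
  -- Otherwise it is at least `k * m / (4 * ν ^ 2)`, and `hL` with `k ≤ k ^ 2` concludes.
  rcases le_total (ν ^ 2) (k * m) with h | h
  · have h1 : 1 / 4 ≤ k * m / 2 / (ν ^ 2 + k * m) := by
      rw [le_div_iff₀ (by positivity)]
      linarith
    have h2 : (1 / 4 : ℝ) ^ 2 ≤ (k * m / 2 / (ν ^ 2 + k * m)) ^ 2 := by gcongr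
    nlinarith
  · have h1 : k * m / (4 * ν ^ 2) ≤ k * m / 2 / (ν ^ 2 + k * m) := by
      rw [div_div]
      exact div_le_div_of_nonneg_left hkm (by positivity) (by linarith)
    calc k ≤ k ^ 2 := by nlinarith
      _ ≤ k ^ 2 * (L * m ^ 2 / ν ^ 4) := by
          refine le_mul_of_one_le_right (by positivity) ?_
          rwa [one_le_div (by positivity)]
      _ = 16 * L * (k * m / (4 * ν ^ 2)) ^ 2 := by
          field_simp
          ring
      _ ≤ _ := by
          have : 0 ≤ L := by linarith
          gcongr

theorem errorProb_le_explicit {N M : ℕ} {ν : ℝ} (hν : 0 < ν) (x : Fin M → ℂ)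
    (hL : 1 ≤ sparsity x) (hM : 2 * sparsity x ≤ M)
    (hlog : 1 ≤ Real.log ((M : ℝ) - sparsity x))
    (hμ : ν ^ 4 ≤ sparsity x * minMagnitude x ^ 4)
    (hN : 256 * sparsity x * Real.log ((M : ℝ) - sparsity x) < N) :
    errorProb (jointTypicalityDecoder N M ν (minMagnitude x ^ 2 / 4) (sparsity x)) ν x ≤
      ENNReal.ofReal (2 * (Real.exp (-(sparsity x * minMagnitude x ^ 4 / ν ^ 4)) +
          Real.exp (-Real.log ((M : ℝ) - sparsity x))) +
        (Real.exp (2 * Real.exp (-Real.log ((M : ℝ) - sparsity x))) - 1)) := by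
  set L := sparsity x
  set I := supp x
  set m := minMagnitude x ^ 2
  set l := Real.log ((M : ℝ) - L)
  have hm4 : minMagnitude x ^ 4 = m ^ 2 := by rw [← pow_mul]
  rw [hm4] at hμ ⊢
  have hm : 0 ≤ m := sq_nonneg _
  have hIL : I.card = L := rfl
  have hL' : (1 : ℝ) ≤ L := by exact_mod_cast hL
  have hM' : 2 * (L : ℝ) ≤ M := by exact_mod_cast hM
  have hLl : (L : ℝ) ≤ L * l := le_mul_of_one_le_right (by linarith) hlog
  have hLN : 2 * L ≤ N := by
    have : 2 * (L : ℝ) ≤ N := by linarith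
    exact_mod_cast this
  obtain ⟨d, hd⟩ : ∃ d, N = d + L := ⟨N - L, by omega⟩
  have hdN : (d : ℝ) ≤ N := by exact_mod_cast (by omega : d ≤ N)
  have hNd : (N : ℝ) ≤ 2 * d := by exact_mod_cast (by omega : N ≤ 2 * d)
  have hdl : 128 * (L * l) ≤ d := by linarith
  have hl0 : 0 ≤ l := by linarith
  -- The tolerance `m / 4` relative to the noise level, capped at 1 for the upper tail bound.
  set t := min (m / (4 * ν ^ 2)) 1
  -- Chosen so that `(ν² + k m) (1 - s J) = ν² + k m / 2` with `k = (I \ J).card`: half of the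
  -- missed energy is given up to fluctuations.
  set s : Finset (Fin M) → ℝ := fun J =>
    (I \ J).card * m / 2 / (ν ^ 2 + (I \ J).card * m)
  have ht0 : 0 ≤ t := le_min (by positivity) zero_le_one
  have htδ : d * (ν ^ 2 * t) ≤ N * (m / 4) := by
    have h1 : ν ^ 2 * t ≤ m / 4 := by
      calc ν ^ 2 * t ≤ ν ^ 2 * (m / (4 * ν ^ 2)) := by gcongr; exact min_le_left _ _
        _ = m / 4 := by field_simp
    gcongr
  have hcard {J : Finset (Fin M)} (hJ : J.card = L) (hne : J ≠ I) :
      1 ≤ ((I \ J).card : ℝ) ∧ ((I \ J).card : ℝ) ≤ L := by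
    constructor
    · have : 0 < (I \ J).card := by
        rw [Finset.card_pos, Finset.sdiff_nonempty]
        exact fun h => hne (Finset.eq_of_subset_of_card_le h (hJ.trans hIL.symm).le).symm
      exact_mod_cast this
    · exact_mod_cast Finset.card_le_card (Finset.sdiff_subset (s := I) (t := J))
  have hs (J : Finset (Fin M)) (hJ : J.card = L) (hne : J ≠ I) : 0 ≤ s J ∧
      d * ν ^ 2 + N * (m / 4) ≤ d * (effectiveVariance ν x J * (1 - s J)) := by
    obtain ⟨hk, -⟩ := hcard hJ hne
    have hτ := le_effectiveVariance ν x J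
    have hp : 0 < ν ^ 2 + (I \ J).card * m := by positivity
    have hs1 : s J ≤ 1 := by
      rw [div_le_one hp]
      nlinarith [sq_nonneg ν, mul_nonneg (zero_le_one.trans hk) hm]
    refine ⟨by positivity, ?_⟩
    have h1 : ν ^ 2 + m / 2 ≤ effectiveVariance ν x J * (1 - s J) := by
      calc ν ^ 2 + m / 2 ≤ ν ^ 2 + (I \ J).card * m / 2 := by
            have : m ≤ (I \ J).card * m := le_mul_of_one_le_left hm hk
            linarith
        _ = (ν ^ 2 + (I \ J).card * m) * (1 - s J) := by
            simp only [s]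
            field_simp
            ring
        _ ≤ _ := by
            have : 0 ≤ 1 - s J := by linarith
            gcongr
    -- Since `N ≤ 2 * d`, the tolerance fits into the half of the missed energy that is kept.
    calc d * ν ^ 2 + N * (m / 4) ≤ d * ν ^ 2 + 2 * d * (m / 4) := by gcongr
      _ = d * (ν ^ 2 + m / 2) := by ring
      _ ≤ _ := by gcongr
  refine (errorProb_le hν x (by omega) hd ht0 (min_le_right _ _) htδ hs).trans ?_
  have hA : Real.exp (-(d * (t ^ 2 / 8))) ≤ Real.exp (-(L * m ^ 2 / ν ^ 4)) + Real.exp (-l) := by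
    rcases le_total (m / (4 * ν ^ 2)) 1 with h | h
    · have ht : t = m / (4 * ν ^ 2) := min_eq_left h
      refine le_add_of_le_of_nonneg (Real.exp_le_exp.2 (neg_le_neg ?_)) (Real.exp_nonneg _)
      calc L * m ^ 2 / ν ^ 4 ≤ L * m ^ 2 / ν ^ 4 * l :=
            le_mul_of_one_le_right (by positivity) hlog
        _ = 128 * (L * l) * (t ^ 2 / 8) := by
            rw [ht]
            field_simp
            ring
        _ ≤ d * (t ^ 2 / 8) := by gcongr
    · have ht : t = 1 := min_eq_right h
      refine le_add_of_nonneg_of_le (Real.exp_nonneg _) (Real.exp_le_exp.2 (neg_le_neg ?_))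
      rw [ht]
      nlinarith
  have hB : ∑ J ∈ (Finset.powersetCard L Finset.univ).erase I,
      Real.exp (-(d * (s J ^ 2 / 2))) ≤ Real.exp (2 * Real.exp (-l)) - 1 := by
    -- The exponent is at least `64 * L * l * s J ^ 2 ≥ 4 * k * l`, with `k = (I \ J).card`. The
    -- weight per element of the symmetric difference is thus `exp (-2l) = (M - L)^(-2)`, small
    -- enough to beat the factor `M ≤ 2 * (M - L)`.
    calc _ ≤ ∑ J ∈ (Finset.powersetCard I.card Finset.univ).erase I,
          Real.exp (-(2 * l)) ^ (2 * (I \ J).card) := by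
          refine Finset.sum_le_sum fun J hJ => ?_
          obtain ⟨hne, hJ⟩ := Finset.mem_erase.1 hJ
          obtain ⟨hk, hkL⟩ := hcard (Finset.mem_powersetCard.1 hJ).2 hne
          rw [← Real.exp_nat_mul, Real.exp_le_exp]
          have h1 : ((I \ J).card : ℝ) ≤ 16 * L * s J ^ 2 := le_sq_energy_gap hν hm hk hkL hμ
          have h2 : l * (I \ J).card ≤ l * (16 * L * s J ^ 2) := by gcongr
          have h3 : 128 * (L * l) * (s J ^ 2 / 2) ≤ d * (s J ^ 2 / 2) := by gcongr
          push_cast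
          linarith
      _ ≤ Real.exp (M * Real.exp (-(2 * l))) - 1 := sum_pow_card_sdiff_le I (Real.exp_nonneg _)
      _ ≤ _ := by
          have hpos : 0 < (M : ℝ) - L := by linarith
          have hexp : Real.exp l = M - L := Real.exp_log hpos
          have hM2 : (M : ℝ) ≤ 2 * Real.exp l := by linarith
          refine sub_le_sub_right (Real.exp_le_exp.2 ?_) 1
          calc M * Real.exp (-(2 * l)) ≤ 2 * Real.exp l * Real.exp (-(2 * l)) := by gcongr
            _ = 2 * Real.exp (-l) := by
                rw [mul_assoc, ← Real.exp_add]
                congr 2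
                ring
  rw [ENNReal.ofReal_add (by positivity) ((Finset.sum_nonneg fun _ _ => by positivity).trans hB),
    ENNReal.ofReal_mul zero_le_two, ENNReal.ofReal_ofNat,
    ← ENNReal.ofReal_sum_of_nonneg fun _ _ => Real.exp_nonneg _]
  gcongr

end SparseRecovery

/-! ### Passage to the limit. -/

theorem mainTheorem7 :
    ∃ (δ : (μ ν : ℝ) → (N L : ℕ) → ℝ) (C : (μ : ℕ → ℝ) → (ν : ℝ) → ℝ),
      (∀ μ ν N L, 0 < μ → 0 < ν → 0 < δ μ ν N L) ∧
      (∀ μ ν, 0 < C μ ν) ∧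
      ∀ (ν : ℝ) (_ : 0 < ν) (x : (M : ℕ) → Fin M → ℂ) (N : ℕ → ℕ),
        (fun M : ℕ => (SparseRecovery.sparsity (x M) : ℝ)) =o[atTop] (fun M : ℕ => (M : ℝ)) →
        Tendsto (fun M : ℕ => (SparseRecovery.sparsity (x M) : ℝ) *
          SparseRecovery.minMagnitude (x M) ^ 4) atTop atTop →
        (∀ᶠ M : ℕ in atTop,
          C (fun M => SparseRecovery.minMagnitude (x M)) ν * SparseRecovery.sparsity (x M) *
            Real.log ((M : ℝ) - SparseRecovery.sparsity (x M)) < N M) →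
        SparseRecovery.AsymptoticReliable N
          (fun M => SparseRecovery.jointTypicalityDecoder (N M) M ν
            (δ (SparseRecovery.minMagnitude (x M)) ν (N M) (SparseRecovery.sparsity (x M)))
            (SparseRecovery.sparsity (x M)))
          ν x := by
  -- An absolute constant works, because `L μ⁴` eventually exceeds `ν⁴`. The value 256 gives `d ≥
  -- 128 * L * l`, where `l = log (M - L)`; the true support then fails with exponent at least `L μ⁴
  -- / ν⁴` or `l`.
  refine ⟨fun μ _ _ _ => μ ^ 2 / 4, fun _ _ => 256, fun μ ν N L hμ _ => by positivity,
    fun _ _ => by norm_num, fun ν hν x N hsub hgrow hN => ?_⟩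
  have hhalf : ∀ᶠ M : ℕ in atTop, 2 * (SparseRecovery.sparsity (x M) : ℝ) ≤ M := by
    filter_upwards [hsub.def (c := 1 / 2) (by norm_num)] with M hM
    rw [Real.norm_natCast, Real.norm_natCast] at hM
    linarith
  have hdiff : Tendsto (fun M : ℕ => (M : ℝ) - SparseRecovery.sparsity (x M)) atTop atTop := by
    refine tendsto_atTop_mono' atTop ?_
      ((tendsto_natCast_atTop_atTop (R := ℝ)).atTop_div_const two_pos)
    filter_upwards [hhalf] with M hM
    linarith
  have hlog := Real.tendsto_log_atTop.comp hdiff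
  have hbound : Tendsto (fun M : ℕ => ENNReal.ofReal
      (2 * (Real.exp (-((SparseRecovery.sparsity (x M) : ℝ) *
          SparseRecovery.minMagnitude (x M) ^ 4 / ν ^ 4)) +
          Real.exp (-Real.log ((M : ℝ) - SparseRecovery.sparsity (x M)))) +
        (Real.exp (2 * Real.exp (-Real.log ((M : ℝ) - SparseRecovery.sparsity (x M)))) - 1)))
      atTop (nhds 0) := by
    have h1 := Real.tendsto_exp_neg_atTop_nhds_zero.comp
      (hgrow.atTop_div_const (by positivity : 0 < ν ^ 4))
    have h2 := Real.tendsto_exp_neg_atTop_nhds_zero.comp hlog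
    have h3 := (Real.continuous_exp.tendsto _).comp (h2.const_mul 2)
    have h4 := ENNReal.tendsto_ofReal (((h1.add h2).const_mul 2).add (h3.sub_const 1))
    simpa using h4
  refine tendsto_of_tendsto_of_tendsto_of_le_of_le' tendsto_const_nhds hbound
    (Eventually.of_forall fun _ => zero_le) ?_
  filter_upwards [hhalf, hN, hlog.eventually_ge_atTop 1, hgrow.eventually_ge_atTop (ν ^ 4)]
    with M h1 h2 h3 h4
  refine SparseRecovery.errorProb_le_explicit hν (x M) ?_ (by exact_mod_cast h1) h3 h4 h2
  -- An empty support would make `L μ⁴` vanish, against `L μ⁴ ≥ ν⁴ > 0`.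
  rw [Nat.one_le_iff_ne_zero]
  intro h0
  have : 0 < ν ^ 4 := by positivity
  rw [h0, Nat.cast_zero, zero_mul] at h4
  linarith
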